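/- Let $X$ be a compact metric space and $\phi : X \to X$ a homeomorphism. Let $x_1, \dots, x_q \in X$ be finitely many points which are not periodic under $\phi$ and whose orbits $\{\phi^n(x_p) : n \in \mathbb Z\}$ are pairwise disjoint. For each $1 \le p \le q$ let $\beta_p < 0$ and let $J_p$ be one of the intervals $(-\infty, \beta_p]$ and $(-\infty, \beta_p)$. Then there is a continuous function $F : X \to \mathbb R$ such that the following two statements hold. (a) For every $p \in \{1, \dots, q\}$ and every $\beta \in \mathbb R$, there is an $e^{\beta F}$-conformal measure concentrated on the $\phi$-orbit of $x_p$ if and only if $\beta \in J_p$. Here an $e^{\beta F}$-conformal measure is a Borel probability measure $m$ on $X$ with $m(\phi(B)) = \int_B e^{\beta F} \, \mathrm{d}m$ for all Borel sets $B \subseteq X$. (b) The flow $\alpha^F$ is approximately inner. Here $C(X) \rtimes_\phi \mathbb Z$ is the universal $C^*$-algebra generated by a copy of $C(X)$ and a unitary $U$ with $U f U^* = f \circ \phi^{-1}$ for all $f \in C(X)$, and $\alpha^F = (\alpha^F_t)_{t \in \mathbb R}$ is the continuous one-parameter group of automorphisms of $C(X) \rtimes_\phi \mathbb Z$ determined by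 $\alpha^F_t(fU) = f U e^{-itF}$ for $f \in C(X)$. A flow $\alpha$ on a unital $C^*$-algebra $A$ is inner if there is a self-adjoint $h \in A$ with $\alpha_t(a) = e^{ith} a e^{-ith}$ for all $t \in \mathbb R$ and $a \in A$. It is approximately inner if there is a sequence $(\alpha^n)$ of inner flows on $A$ such that, for every $a \in A$, $\|\alpha_t(a) - \alpha^n_t(a)\| \to 0$ as $n \to \infty$, uniformly for $t$ in compact subsets of $\mathbb R$. -/

import Mathlib

open scoped ENNReal CStarAlgebra

universe u v

noncomputable section

/-! ## Orbits and conformal measures -/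

/-- The two-sided orbit of `x` under the homeomorphism `φ`. -/
def homeoOrbit {X : Type u} [TopologicalSpace X] (φ : X ≃ₜ X) (x : X) : Set X :=
  Set.range fun n : ℤ => (φ ^ n) x

/-- `m` is an `e^{βF}`-conformal measure for `φ`: a Borel probability measure such that
`m(φ(B)) = ∫_B e^{βF} dm` for all Borel sets `B`. -/
def IsConformalMeasure {X : Type u} [TopologicalSpace X] [MeasurableSpace X] (φ : X ≃ₜ X)
    (F : C(X, ℝ)) (β : ℝ) (m : MeasureTheory.Measure X) : Prop :=
  MeasureTheory.IsProbabilityMeasure m ∧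
    ∀ B : Set X, MeasurableSet B →
      m (φ '' B) = ∫⁻ x in B, ENNReal.ofReal (Real.exp (β * F x)) ∂m

/-- `m` is concentrated on `S`: the complement of `S` is a null set. -/
def IsConcentratedOn {X : Type u} [MeasurableSpace X] (m : MeasureTheory.Measure X)
    (S : Set X) : Prop :=
  m Sᶜ = 0

/-! ## Flows on unital C*-algebras -/

/-- A flow on `A`: a strongly continuous one-parameter group of *-automorphisms. (Each `α_t` is
invertible with inverse `α_{-t}`, by the group law.) -/
structure CStarFlow (A : Type v) [CStarAlgebra A] where
  toFun : ℝ → A →⋆ₐ[ℂ] A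
  map_zero : toFun 0 = StarAlgHom.id ℂ A
  map_add : ∀ s t, toFun (s + t) = (toFun s).comp (toFun t)
  continuous : ∀ a, Continuous fun t => toFun t a

/-- The flow is inner: `α_t(a) = e^{ith} a e^{-ith}` for some self-adjoint `h ∈ A`. -/
def CStarFlow.IsInner {A : Type v} [CStarAlgebra A] (α : CStarFlow A) : Prop :=
  ∃ h : A, IsSelfAdjoint h ∧ ∀ (t : ℝ) (a : A),
    α.toFun t a = NormedSpace.exp ((Complex.I * t) • h) * a *
      NormedSpace.exp (-((Complex.I * t) • h))

/-- The flow is approximately inner: there are inner flows `α^n` such that, for every `a ∈ A`,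
`‖α_t(a) - α^n_t(a)‖ → 0` uniformly for `t` in compact subsets of `ℝ`. -/
def CStarFlow.IsApproximatelyInner {A : Type v} [CStarAlgebra A] (α : CStarFlow A) : Prop :=
  ∃ αs : ℕ → CStarFlow A, (∀ n, (αs n).IsInner) ∧
    ∀ (a : A) (K : Set ℝ), IsCompact K →
      TendstoUniformlyOn (fun n t => (αs n).toFun t a) (fun t => α.toFun t a) Filter.atTop K

/-! ## The crossed product `C(X) ⋊_φ ℤ`

The universal C*-algebra generated by a copy of `C(X)` and a unitary `U` with
`U f U* = f ∘ φ⁻¹` is constructed as the C*-algebra generated by the images of `C(X)` and of `U`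
in the product of all covariant representations of `(X, φ)` in C*-algebras. -/

/-- A covariant representation of `(X, φ)` in a unital C*-algebra `B`: a unital *-homomorphism
`π : C(X) → B` and a unitary `V ∈ B` with `V π(f) V* = π(f ∘ φ⁻¹)`.
It is enough to let `B` range over the universe of `X`: a C*-algebra (in any universe) which is
generated by an image of `C(X)` and one unitary is the closure of an image of a set in the universe
of `X`, and hence isomorphic to a C*-algebra in that universe. The zero algebra is left out because
it does not contribute to the universal norm. -/
structure CovariantRep {X : Type u} [TopologicalSpace X] [CompactSpace X] (φ : X ≃ₜ X) :
    Type (u + 1) where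
  B : Type u
  [cstar : CStarAlgebra B]
  [nontriv : Nontrivial B]
  π : C(X, ℂ) →⋆ₐ[ℂ] B
  V : unitary B
  covariant : ∀ f : C(X, ℂ), (V : B) * π f * star (V : B) = π (f.comp (φ.symm : C(X, X)))

attribute [instance] CovariantRep.cstar CovariantRep.nontriv

/-- The C*-algebra of bounded families `(a_r)`, `r` a covariant representation, `a_r ∈ B_r`. -/
abbrev RepProd {X : Type u} [TopologicalSpace X] [CompactSpace X] (φ : X ≃ₜ X) : Type (u + 1) :=
  lp (fun r : CovariantRep φ => r.B) ∞

instance {X : Type u} [TopologicalSpace X] [CompactSpace X] (φ : X ≃ₜ X) :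
    CStarAlgebra (RepProd φ) where

/-- `f ↦ (π_r(f))_r`. -/
def RepProd.ofFun {X : Type u} [TopologicalSpace X] [CompactSpace X] (φ : X ≃ₜ X) :
    C(X, ℂ) →⋆ₐ[ℂ] RepProd φ where
  toFun f := ⟨fun r => r.π f, memℓp_infty ⟨‖f‖, by
    rintro _ ⟨r, rfl⟩
    exact NonUnitalStarAlgHom.norm_apply_le r.π f⟩⟩
  map_one' := by ext r; simp
  map_mul' f g := by ext r; simp
  map_zero' := by ext r; simp
  map_add' f g := by ext r; simp; rfl
  commutes' c := by ext r; simp [AlgHomClass.commutes]; rfl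
  map_star' f := by ext r; simp [map_star]

/-- The family `(V_r)_r`. -/
def RepProd.ofUnitary {X : Type u} [TopologicalSpace X] [CompactSpace X] (φ : X ≃ₜ X) :
    RepProd φ :=
  ⟨fun r => (r.V : r.B), memℓp_infty ⟨1, by
    rintro _ ⟨r, rfl⟩
    exact (CStarRing.norm_coe_unitary r.V).le⟩⟩

/-- The closed *-subalgebra generated by the images of `C(X)` and `U`. -/
def CrossedProduct.subalgebra {X : Type u} [TopologicalSpace X] [CompactSpace X] (φ : X ≃ₜ X) :
    StarSubalgebra ℂ (RepProd φ) :=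
  (StarAlgebra.adjoin ℂ
    (Set.range (RepProd.ofFun φ) ∪ {RepProd.ofUnitary φ})).topologicalClosure

theorem CrossedProduct.isClosed_subalgebra {X : Type u} [TopologicalSpace X] [CompactSpace X]
    (φ : X ≃ₜ X) : IsClosed (CrossedProduct.subalgebra φ : Set (RepProd φ)) :=
  StarSubalgebra.isClosed_topologicalClosure _

/-- The crossed product C*-algebra `C(X) ⋊_φ ℤ`. -/
abbrev CrossedProduct {X : Type u} [TopologicalSpace X] [CompactSpace X] (φ : X ≃ₜ X) :
    Type (u + 1) :=
  CrossedProduct.subalgebra φ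

instance {X : Type u} [TopologicalSpace X] [CompactSpace X] (φ : X ≃ₜ X) :
    CStarAlgebra (CrossedProduct φ) :=
  StarSubalgebra.cstarAlgebra _ (h_closed := CrossedProduct.isClosed_subalgebra φ)

theorem CrossedProduct.ofFun_mem {X : Type u} [TopologicalSpace X] [CompactSpace X]
    (φ : X ≃ₜ X) (f : C(X, ℂ)) : RepProd.ofFun φ f ∈ CrossedProduct.subalgebra φ :=
  StarSubalgebra.le_topologicalClosure _
    (StarAlgebra.subset_adjoin ℂ _ (Or.inl ⟨f, rfl⟩))

theorem CrossedProduct.ofUnitary_mem {X : Type u} [TopologicalSpace X] [CompactSpace X]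
    (φ : X ≃ₜ X) : RepProd.ofUnitary φ ∈ CrossedProduct.subalgebra φ :=
  StarSubalgebra.le_topologicalClosure _
    (StarAlgebra.subset_adjoin ℂ _ (Or.inr rfl))

/-- The canonical copy of `C(X)` in the crossed product. -/
def CrossedProduct.ι {X : Type u} [TopologicalSpace X] [CompactSpace X] (φ : X ≃ₜ X) :
    C(X, ℂ) →⋆ₐ[ℂ] CrossedProduct φ :=
  (RepProd.ofFun φ).codRestrict (CrossedProduct.subalgebra φ) (CrossedProduct.ofFun_mem φ)

/-- The canonical unitary `U` of the crossed product. -/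
def CrossedProduct.U {X : Type u} [TopologicalSpace X] [CompactSpace X] (φ : X ≃ₜ X) :
    CrossedProduct φ :=
  ⟨RepProd.ofUnitary φ, CrossedProduct.ofUnitary_mem φ⟩

theorem CrossedProduct.U_mem_unitary {X : Type u} [TopologicalSpace X] [CompactSpace X]
    (φ : X ≃ₜ X) : CrossedProduct.U φ ∈ unitary (CrossedProduct φ) := by
  rw [Unitary.mem_iff]
  constructor
  · apply Subtype.ext
    ext r
    exact (Unitary.mem_iff.1 r.V.2).1
  · apply Subtype.ext
    ext r
    exact (Unitary.mem_iff.1 r.V.2).2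

/-- The covariance relation `U f U* = f ∘ φ⁻¹`. -/
theorem CrossedProduct.covariance {X : Type u} [TopologicalSpace X] [CompactSpace X]
    (φ : X ≃ₜ X) (f : C(X, ℂ)) :
    CrossedProduct.U φ * CrossedProduct.ι φ f * star (CrossedProduct.U φ) =
      CrossedProduct.ι φ (f.comp (φ.symm : C(X, X))) := by
  apply Subtype.ext
  ext r
  exact r.covariant f

/-- The *-homomorphism out of the crossed product given by a covariant representation. -/
def CrossedProduct.lift {X : Type u} [TopologicalSpace X] [CompactSpace X] {φ : X ≃ₜ X}
    (r : CovariantRep φ) : CrossedProduct φ →⋆ₐ[ℂ] r.B where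
  toFun a := a.1 r
  map_one' := rfl
  map_mul' _ _ := rfl
  map_zero' := rfl
  map_add' _ _ := rfl
  commutes' _ := rfl
  map_star' _ := rfl

theorem CrossedProduct.lift_ι {X : Type u} [TopologicalSpace X] [CompactSpace X] {φ : X ≃ₜ X}
    (r : CovariantRep φ) (f : C(X, ℂ)) :
    CrossedProduct.lift r (CrossedProduct.ι φ f) = r.π f := rfl

theorem CrossedProduct.lift_U {X : Type u} [TopologicalSpace X] [CompactSpace X] {φ : X ≃ₜ X}
    (r : CovariantRep φ) : CrossedProduct.lift r (CrossedProduct.U φ) = r.V := rfl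

/-! ## The flow `α^F` -/

/-- The function `e^{-itF} ∈ C(X)`. -/
def phaseFun {X : Type u} [TopologicalSpace X] (F : C(X, ℝ)) (t : ℝ) : C(X, ℂ) where
  toFun x := Complex.exp (-(Complex.I * t * F x))
  continuous_toFun := by fun_prop

theorem star_phaseFun {X : Type u} [TopologicalSpace X] (F : C(X, ℝ)) (t : ℝ) :
    star (phaseFun F t) = phaseFun F (-t) := by
  ext x
  simp [phaseFun, ← Complex.exp_conj]

theorem phaseFun_zero {X : Type u} [TopologicalSpace X] (F : C(X, ℝ)) :
    phaseFun F 0 = 1 := by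
  ext x
  simp [phaseFun]

theorem phaseFun_add {X : Type u} [TopologicalSpace X] (F : C(X, ℝ)) (s t : ℝ) :
    phaseFun F (s + t) = phaseFun F s * phaseFun F t := by
  ext x
  simp only [phaseFun, ContinuousMap.coe_mk, ContinuousMap.mul_apply, ← Complex.exp_add]
  congr 1
  push_cast
  ring

theorem continuous_phaseFun {X : Type u} [TopologicalSpace X] (F : C(X, ℝ)) :
    Continuous (phaseFun F) := by
  apply ContinuousMap.continuous_of_continuous_uncurry
  simp only [Function.uncurry_def, phaseFun, ContinuousMap.coe_mk]
  fun_prop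

theorem phaseFun_mem_unitary {X : Type u} [TopologicalSpace X] [CompactSpace X]
    (F : C(X, ℝ)) (t : ℝ) : phaseFun F t ∈ unitary C(X, ℂ) := by
  rw [Unitary.mem_iff, star_phaseFun, ← phaseFun_add, ← phaseFun_add]
  simp [phaseFun_zero]

/-- The covariant representation `(π, V π(e^{-itF}))`. -/
@[reducible] def CovariantRep.twist {X : Type u} [TopologicalSpace X] [CompactSpace X]
    {φ : X ≃ₜ X} (F : C(X, ℝ)) (t : ℝ) (r : CovariantRep φ) : CovariantRep φ where
  B := r.B
  π := r.π
  V := r.V * ⟨r.π (phaseFun F t), Unitary.map_mem r.π (phaseFun_mem_unitary F t)⟩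
  covariant f := by
    have h : r.π (phaseFun F t) * r.π f * r.π (star (phaseFun F t)) = r.π f := by
      rw [← map_mul, ← map_mul, mul_right_comm, (Unitary.mem_iff.1 (phaseFun_mem_unitary F t)).2,
        one_mul]
    rw [← r.covariant f]
    conv_rhs => rw [← h]
    simp only [Submonoid.coe_mul, star_mul, map_star, mul_assoc]

theorem CovariantRep.twist_zero {X : Type u} [TopologicalSpace X] [CompactSpace X]
    {φ : X ≃ₜ X} (F : C(X, ℝ)) (r : CovariantRep φ) : r.twist F 0 = r := by
  cases r
  simp [CovariantRep.twist, phaseFun_zero]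

theorem CovariantRep.twist_twist {X : Type u} [TopologicalSpace X] [CompactSpace X]
    {φ : X ≃ₜ X} (F : C(X, ℝ)) (s t : ℝ) (r : CovariantRep φ) :
    (r.twist F s).twist F t = r.twist F (s + t) := by
  cases r
  simp only [CovariantRep.twist, CovariantRep.mk.injEq, heq_eq_eq, true_and]
  ext
  simp only [Submonoid.coe_mul, mul_assoc]
  rw [← map_mul, ← phaseFun_add]

/-- Reindexing along `r ↦ r.twist F t`. -/
def RepProd.twist {X : Type u} [TopologicalSpace X] [CompactSpace X] (φ : X ≃ₜ X)
    (F : C(X, ℝ)) (t : ℝ) : RepProd φ →⋆ₐ[ℂ] RepProd φ where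
  toFun a := ⟨fun r => a (r.twist F t), memℓp_infty ⟨‖a‖, by
    rintro _ ⟨r, rfl⟩
    exact lp.norm_apply_le_norm ENNReal.top_ne_zero a (r.twist F t)⟩⟩
  map_one' := rfl
  map_mul' _ _ := rfl
  map_zero' := rfl
  map_add' _ _ := rfl
  commutes' _ := rfl
  map_star' _ := rfl

theorem RepProd.twist_ofUnitary {X : Type u} [TopologicalSpace X] [CompactSpace X]
    (φ : X ≃ₜ X) (F : C(X, ℝ)) (t : ℝ) :
    RepProd.twist φ F t (RepProd.ofUnitary φ) =
      RepProd.ofUnitary φ * RepProd.ofFun φ (phaseFun F t) := rfl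

theorem RepProd.twist_mem {X : Type u} [TopologicalSpace X] [CompactSpace X] (φ : X ≃ₜ X)
    (F : C(X, ℝ)) (t : ℝ) (a : RepProd φ) (ha : a ∈ CrossedProduct.subalgebra φ) :
    RepProd.twist φ F t a ∈ CrossedProduct.subalgebra φ := by
  have hle : CrossedProduct.subalgebra φ ≤
      (CrossedProduct.subalgebra φ).comap (RepProd.twist φ F t) := by
    refine StarSubalgebra.topologicalClosure_minimal (StarAlgebra.adjoin_le ?_) ?_
    · rintro _ (⟨f, rfl⟩ | rfl)
      · exact CrossedProduct.ofFun_mem φ f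
      · exact mul_mem (CrossedProduct.ofUnitary_mem φ) (CrossedProduct.ofFun_mem φ _)
    · exact (CrossedProduct.isClosed_subalgebra φ).preimage
        (map_continuous (RepProd.twist φ F t))
  exact hle ha

theorem RepProd.continuous_twist {X : Type u} [TopologicalSpace X] [CompactSpace X] (φ : X ≃ₜ X)
    (F : C(X, ℝ)) (a : RepProd φ) (ha : a ∈ CrossedProduct.subalgebra φ) :
    Continuous fun t => RepProd.twist φ F t a := by
  have hS : ∀ b ∈ StarAlgebra.adjoin ℂ (Set.range (RepProd.ofFun φ) ∪ {RepProd.ofUnitary φ}),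
      Continuous fun t => RepProd.twist φ F t b := by
    intro b hb
    induction hb using StarAlgebra.adjoin_induction with
    | mem x hx =>
      rcases hx with ⟨f, rfl⟩ | rfl
      · exact (continuous_const : Continuous fun _ : ℝ => RepProd.ofFun φ f)
      · simp only [RepProd.twist_ofUnitary]
        exact continuous_const.mul ((map_continuous (RepProd.ofFun φ)).comp
          (continuous_phaseFun F))
    | algebraMap c => simpa only [AlgHomClass.commutes] using continuous_const
    | add x y _ _ hx hy => simp only [_root_.map_add]; exact hx.add hy
    | mul x y _ _ hx hy => simp only [_root_.map_mul]; exact hx.mul hy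
    | star x _ hx => simp only [StarHomClass.map_star]; exact hx.star
  refine continuous_of_uniform_approx_of_continuous fun u hu => ?_
  obtain ⟨ε, hε, hεu⟩ := Metric.mem_uniformity_dist.1 hu
  obtain ⟨b, hb, hab⟩ := Metric.mem_closure_iff.1 ha ε hε
  refine ⟨fun t => RepProd.twist φ F t b, hS b hb, fun t => hεu ?_⟩
  refine lt_of_le_of_lt ?_ hab
  rw [dist_eq_norm, dist_eq_norm, ← map_sub]
  exact NonUnitalStarAlgHom.norm_apply_le _ _

/-- The flow `α^F` on `C(X) ⋊_φ ℤ`, determined by `α^F_t(f U) = f U e^{-itF}`. -/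
def potentialFlow {X : Type u} [TopologicalSpace X] [CompactSpace X] (φ : X ≃ₜ X)
    (F : C(X, ℝ)) : CStarFlow (CrossedProduct φ) where
  toFun t := ((RepProd.twist φ F t).comp (CrossedProduct.subalgebra φ).subtype).codRestrict
    (CrossedProduct.subalgebra φ) fun a => RepProd.twist_mem φ F t a a.2
  map_zero := by
    ext a r
    exact eq_of_heq (congr_arg_heq (fun r => a.1 r) (r.twist_zero F))
  map_add s t := by
    ext a r
    have h := congr_arg_heq (fun r => a.1 r) (r.twist_twist F s t)
    exact (eq_of_heq h).symm
  continuous a := (RepProd.continuous_twist φ F a a.2).subtype_mk _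

theorem potentialFlow_apply {X : Type u} [TopologicalSpace X] [CompactSpace X] (φ : X ≃ₜ X)
    (F : C(X, ℝ)) (t : ℝ) (f : C(X, ℂ)) :
    (potentialFlow φ F).toFun t (CrossedProduct.ι φ f * CrossedProduct.U φ) =
      CrossedProduct.ι φ f * CrossedProduct.U φ * CrossedProduct.ι φ (phaseFun F t) := by
  rw [mul_assoc]
  rfl

end

noncomputable section

/-! Both statements are reduced to facts about coboundaries and their Birkhoff sums. Let `s` satisfy
`s (n + 1) = s n + F (φ^n x)`. Conformality fixes the ratio of the masses of consecutive orbit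
points, so the mass of `φ^n x` is proportional to `exp (β * s n)`. Hence a conformal measure on the
orbit exists exactly when these weights are summable (`exists_conformal_iff_summable`). If `F = g -
g ∘ φ`, then `α^F` is implemented by `exp (it ι(g))`, so a uniform limit of coboundaries gives an
approximately inner flow (`potentialFlow_isApproximatelyInner`).

It remains to find `F = ∑ (G_k - G_k ∘ φ)`, converging in norm, with prescribed growth of `s`. Each
`G_k` is a plateau along the orbit of `x_p`: it equals `a_k` (depending on `p`) for `|n| ≤ N_k`,
vanishes from `2 N_k` on for as long as needed, and changes by at most `O(b_k / N_k)` under `φ`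
(`exists_slowly_varying`). So `s n` is within `B_k` of `a_k` for `2 N_k ≤ |n| ≤ N_{k+1}`
(`exists_potential`).

With `N_{k+1}` of order `exp b_k`, the `k`-th block of weights contributes about `exp (b_k + β
a_k)`. Choosing `a_k` close to `b_k / |β_p|` puts the critical exponent at `β_p`. A correction of
size `(k + 1) B_k`, small against `b_k` but large against the error `B_k`, decides by its sign
whether the critical exponent itself is included (`Scales.summable_iff`). -/

/-! ### Conformal measures on a single orbit -/

theorem homeo_zpow_injective {X : Type u} [TopologicalSpace X] (φ : X ≃ₜ X) (x : X)
    (hx : x ∉ Function.periodicPts φ) : Function.Injective fun n : ℤ => (φ ^ n) x := by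
  have key : ∀ (m : ℤ) (n : ℕ), (φ ^ (m + n)) x = (φ ^ m) x → n = 0 := by
    intro m n h
    by_contra hn
    apply hx
    refine ⟨n, Nat.pos_of_ne_zero hn, ?_⟩
    rw [zpow_add, Homeomorph.mul_apply] at h
    have h2 := (φ ^ m).injective h
    rw [Function.IsPeriodicPt, Function.IsFixedPt]
    conv_rhs => rw [← h2]
    clear h h2 hn
    induction n with
    | zero => simp
    | succ n ih =>
      rw [Function.iterate_succ_apply', ih]
      push_cast
      rw [add_comm, zpow_add, zpow_one, Homeomorph.mul_apply]
  intro m n h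
  dsimp only at h
  rcases le_total m n with hmn | hmn
  · obtain ⟨k, rfl⟩ := Int.le.dest hmn
    rw [key m k h.symm]; simp
  · obtain ⟨k, rfl⟩ := Int.le.dest hmn
    rw [key n k h]; simp

theorem homeo_zpow_add_one_apply {X : Type u} [TopologicalSpace X] (φ : X ≃ₜ X) (x : X) (n : ℤ) :
    (φ ^ (n + 1)) x = φ ((φ ^ n) x) := by
  rw [add_comm, zpow_add, zpow_one, Homeomorph.mul_apply]

theorem exists_conformal_iff_summable {X : Type u} [TopologicalSpace X] [T1Space X]
    [MeasurableSpace X] [BorelSpace X] (φ : X ≃ₜ X) (F : C(X, ℝ)) (x : X)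
    (hx : x ∉ Function.periodicPts φ) (s : ℤ → ℝ)
    (hs : ∀ n, s (n + 1) = s n + F ((φ ^ n) x)) (β : ℝ) :
    (∃ m : MeasureTheory.Measure X,
      IsConformalMeasure φ F β m ∧ IsConcentratedOn m (homeoOrbit φ x)) ↔
      Summable fun n => Real.exp (β * s n) := by
  have hinj := homeo_zpow_injective φ x hx
  have hmeas : MeasurableSet (homeoOrbit φ x) :=
    (Set.countable_range _).measurableSet
  have hexp : ∀ n, ENNReal.ofReal (Real.exp (β * s (n + 1))) =
      ENNReal.ofReal (Real.exp (β * F ((φ ^ n) x))) * ENNReal.ofReal (Real.exp (β * s n)) := by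
    intro n
    rw [← ENNReal.ofReal_mul (Real.exp_pos _).le, ← Real.exp_add, hs]
    ring_nf
  constructor
  · rintro ⟨m, ⟨hprob, hconf⟩, hconc⟩
    have hstep : ∀ n : ℤ, m {(φ ^ (n + 1)) x} =
        ENNReal.ofReal (Real.exp (β * F ((φ ^ n) x))) * m {(φ ^ n) x} := by
      intro n
      have h := hconf {(φ ^ n) x} (measurableSet_singleton _)
      rwa [Set.image_singleton, MeasureTheory.lintegral_singleton,
        ← homeo_zpow_add_one_apply] at h
    -- Since `s` is only determined up to a constant, `s 0` need not vanish and its weight is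
    -- carried along.
    have hmul : ∀ n : ℤ, m {(φ ^ n) x} * ENNReal.ofReal (Real.exp (β * s 0)) =
        ENNReal.ofReal (Real.exp (β * s n)) * m {(φ ^ (0 : ℤ)) x} := by
      intro n
      induction n using Int.induction_on with
      | zero => rw [mul_comm]
      | succ i ih => rw [hstep, mul_assoc, ih, hexp, mul_assoc]
      | pred i ih =>
        have h1 := hstep (-(i : ℤ) - 1)
        have h2 := hexp (-(i : ℤ) - 1)
        rw [sub_add_cancel] at h1 h2
        rw [h1, h2, mul_assoc, mul_assoc] at ih
        exact (ENNReal.mul_right_inj (by simp [Real.exp_pos]) (by simp)).1 ih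
    have hsum : ∑' n : ℤ, m {(φ ^ n) x} = 1 := by
      have h1 : m (homeoOrbit φ x) = 1 := by
        rw [← MeasureTheory.prob_compl_eq_zero_iff hmeas]; exact hconc
      rw [← h1, homeoOrbit, ← Set.iUnion_singleton_eq_range,
        MeasureTheory.measure_iUnion _ fun _ => measurableSet_singleton _]
      intro i j hij
      simpa using fun h => hij (hinj h)
    have h0 : m {(φ ^ (0 : ℤ)) x} ≠ 0 := by
      intro h0
      have : ∀ n : ℤ, m {(φ ^ n) x} = 0 := by
        intro n
        have := hmul n
        rw [h0, mul_zero, mul_eq_zero] at this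
        exact this.resolve_right (by simp [Real.exp_pos])
      simp [this] at hsum
    have hfin : ∑' n : ℤ, ENNReal.ofReal (Real.exp (β * s n)) ≠ ∞ := by
      intro htop
      have : ∑' n : ℤ, m {(φ ^ n) x} * ENNReal.ofReal (Real.exp (β * s 0)) = ∞ := by
        simp_rw [hmul, ENNReal.tsum_mul_right, htop, ENNReal.top_mul h0]
      rw [ENNReal.tsum_mul_right, hsum, one_mul] at this
      exact ENNReal.ofReal_ne_top this
    exact (ENNReal.summable_toReal hfin).congr fun n => by
      rw [ENNReal.toReal_ofReal (Real.exp_pos _).le]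
  · intro hsum
    set w : ℤ → ℝ≥0∞ := fun n => ENNReal.ofReal (Real.exp (β * s n)) with hw
    set Z : ℝ≥0∞ := ∑' n, w n with hZ
    have hZtop : Z ≠ ∞ := hsum.tsum_ofReal_ne_top
    have hZ0 : Z ≠ 0 := by
      intro h
      have := ENNReal.tsum_eq_zero.1 h 0
      simp [hw, Real.exp_pos, not_le.2] at this
    set ν : MeasureTheory.Measure X :=
      MeasureTheory.Measure.sum fun n : ℤ => w n • MeasureTheory.Measure.dirac ((φ ^ n) x) with hν
    have hνapp : ∀ B, MeasurableSet B →
        ν B = ∑' n : ℤ, w n * B.indicator 1 ((φ ^ n) x) := by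
      intro B hB
      rw [hν, MeasureTheory.Measure.sum_apply _ hB]
      simp [MeasureTheory.Measure.dirac_apply' _ hB]
    refine ⟨Z⁻¹ • ν, ⟨⟨?_⟩, ?_⟩, ?_⟩
    · rw [MeasureTheory.Measure.smul_apply, hνapp _ MeasurableSet.univ]
      simp [← hZ, ENNReal.inv_mul_cancel hZ0 hZtop]
    · intro B hB
      have hφB : MeasurableSet (φ '' B) := φ.measurableEmbedding.measurableSet_image.2 hB
      rw [MeasureTheory.Measure.smul_apply, MeasureTheory.Measure.restrict_smul,
        MeasureTheory.lintegral_smul_measure, hνapp _ hφB, hν,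
        MeasureTheory.Measure.restrict_sum _ hB, MeasureTheory.lintegral_sum_measure]
      congr 1
      -- The atom at `φ^(n+1) x` in `φ '' B` corresponds to the atom at `φ^n x` in `B`; after this
      -- shift the two sums agree term by term.
      rw [← (Equiv.addRight (1 : ℤ)).tsum_eq]
      refine tsum_congr fun n => ?_
      rw [MeasureTheory.Measure.restrict_smul, MeasureTheory.lintegral_smul_measure,
        ← MeasureTheory.lintegral_indicator hB, MeasureTheory.lintegral_dirac']
      · rw [Equiv.coe_addRight, homeo_zpow_add_one_apply]
        simp only [hw, hexp, smul_eq_mul]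
        by_cases h : (φ ^ n) x ∈ B
        · simp [h, mul_comm]
        · simp [h]
      · refine Measurable.indicator ?_ hB
        fun_prop
    · rw [IsConcentratedOn, MeasureTheory.Measure.smul_apply, hνapp _ hmeas.compl]
      simp [homeoOrbit]

/-! ### Limits of coboundaries and approximate innerness -/

theorem phaseFun_jointly_continuous {X : Type u} [TopologicalSpace X] [CompactSpace X] :
    Continuous fun p : C(X, ℝ) × ℝ => phaseFun p.1 p.2 := by
  apply ContinuousMap.continuous_of_continuous_uncurry
  simp only [Function.uncurry_def, phaseFun, ContinuousMap.coe_mk]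
  fun_prop

/-- Joint continuity in the potential and the time yields convergence uniform on compact time sets
when potentials converge. The twists are contractive, so approximating `a` by elements of the
generated star subalgebra is uniform in both parameters, and only generators need checking. -/
theorem continuous_potentialFlow_apply {X : Type u} [TopologicalSpace X] [CompactSpace X]
    (φ : X ≃ₜ X) (a : CrossedProduct φ) :
    Continuous fun p : C(X, ℝ) × ℝ => (potentialFlow φ p.1).toFun p.2 a := by
  refine Continuous.subtype_mk (f := fun p : C(X, ℝ) × ℝ => RepProd.twist φ p.1 p.2 a.1) ?_ _
  have hS : ∀ b ∈ StarAlgebra.adjoin ℂ (Set.range (RepProd.ofFun φ) ∪ {RepProd.ofUnitary φ}),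
      Continuous fun p : C(X, ℝ) × ℝ => RepProd.twist φ p.1 p.2 b := by
    intro b hb
    induction hb using StarAlgebra.adjoin_induction with
    | mem x hx =>
      rcases hx with ⟨f, rfl⟩ | rfl
      · exact (continuous_const : Continuous fun _ : C(X, ℝ) × ℝ => RepProd.ofFun φ f)
      · simp only [RepProd.twist_ofUnitary]
        exact continuous_const.mul ((map_continuous (RepProd.ofFun φ)).comp
          phaseFun_jointly_continuous)
    | algebraMap c => simpa only [AlgHomClass.commutes] using continuous_const
    | add x y _ _ hx hy => simp only [_root_.map_add]; exact hx.add hy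
    | mul x y _ _ hx hy => simp only [_root_.map_mul]; exact hx.mul hy
    | star x _ hx => simp only [StarHomClass.map_star]; exact hx.star
  refine continuous_of_uniform_approx_of_continuous fun u hu => ?_
  obtain ⟨ε, hε, hεu⟩ := Metric.mem_uniformity_dist.1 hu
  obtain ⟨b, hb, hab⟩ := Metric.mem_closure_iff.1 a.2 ε hε
  refine ⟨fun p => RepProd.twist φ p.1 p.2 b, hS b hb, fun t => hεu ?_⟩
  refine lt_of_le_of_lt ?_ hab
  rw [dist_eq_norm, dist_eq_norm, ← map_sub]
  exact NonUnitalStarAlgHom.norm_apply_le _ _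

/-- A unitary of the form `ι(u)` conjugates `U` to `U ι((u ∘ φ) u*)`. -/
theorem CrossedProduct.conj_U {X : Type u} [TopologicalSpace X] [CompactSpace X] (φ : X ≃ₜ X)
    (f g : C(X, ℂ)) :
    ι φ f * U φ * ι φ g = U φ * ι φ (f.comp (φ : C(X, X)) * g) := by
  have h := covariance φ (f.comp (φ : C(X, X)))
  have h2 : (f.comp (φ : C(X, X))).comp (φ.symm : C(X, X)) = f := by
    ext x; simp
  rw [h2] at h
  rw [← h, map_mul, mul_assoc _ (star _), (Unitary.mem_iff.1 (U_mem_unitary φ)).1, mul_one,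
    mul_assoc]

theorem NormedSpace.map_exp_of_complex {A B : Type*} [CStarAlgebra A] [CStarAlgebra B]
    (f : A →⋆ₐ[ℂ] B) (a : A) : f (NormedSpace.exp a) = NormedSpace.exp (f a) := by
  let : NormedAlgebra ℚ A := NormedAlgebra.restrictScalars ℚ ℂ A
  let : NormedAlgebra ℚ B := NormedAlgebra.restrictScalars ℚ ℂ B
  exact NormedSpace.map_exp f (map_continuous f) a

/-- Conjugation by `ι(e^{itg})` fixes `C(X)`, and moving this unitary past `U` replaces `g` by `g ∘
φ`, so `U` goes to `U ι(e^{-it(g - g ∘ φ)})`. Agreement on the generators passes to the closure. -/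
theorem potentialFlow_isInner_of_coboundary {X : Type u} [TopologicalSpace X] [CompactSpace X]
    (φ : X ≃ₜ X) (g : C(X, ℝ)) : (potentialFlow φ (g - g.comp (φ : C(X, X)))).IsInner := by
  set G : C(X, ℂ) := ⟨fun x => (g x : ℂ), by fun_prop⟩ with hG
  have hGs : IsSelfAdjoint G := by ext x; simp [hG]
  refine ⟨CrossedProduct.ι φ G, hGs.map _, fun t a => ?_⟩
  have hexp : ∀ c : ℂ, NormedSpace.exp (c • CrossedProduct.ι φ G) =
      CrossedProduct.ι φ (NormedSpace.exp (c • G)) := by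
    intro c
    rw [NormedSpace.map_exp_of_complex (CrossedProduct.ι φ), map_smul]
  have hphase : ∀ r : ℝ, NormedSpace.exp (-((Complex.I * r) • G)) = phaseFun g r := by
    intro r
    ext x
    have := NormedSpace.map_exp_of_complex (ContinuousMap.evalStarAlgHom ℂ ℂ x)
      (-((Complex.I * r) • G))
    simp only [ContinuousMap.evalStarAlgHom_apply] at this
    rw [this, ← Complex.exp_eq_exp_ℂ]
    simp [phaseFun, hG]
  have hphase' : NormedSpace.exp ((Complex.I * t) • G) = phaseFun g (-t) := by
    rw [← hphase]; congr 1; simp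
  rw [← neg_smul, hexp, hexp, neg_smul, hphase, hphase']
  set V := CrossedProduct.ι φ (phaseFun g (-t))
  set W := CrossedProduct.ι φ (phaseFun g t)
  have hWV : W * V = 1 := by
    rw [← map_mul, ← phaseFun_add]; simp [phaseFun_zero]
  have hVW : V * W = 1 := by
    rw [← map_mul, ← phaseFun_add]; simp [phaseFun_zero]
  have hVs : star V = W := by rw [← map_star, star_phaseFun, neg_neg]
  have hWs : star W = V := by rw [← hVs, star_star]
  let P : RepProd φ → Prop := fun b => RepProd.twist φ (g - g.comp (φ : C(X, X))) t b =
    V.1 * b * W.1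
  have hWV' : W.1 * V.1 = 1 := congrArg Subtype.val hWV
  have hVW' : V.1 * W.1 = 1 := congrArg Subtype.val hVW
  have hVs' : star V.1 = W.1 := congrArg Subtype.val hVs
  have hWs' : star W.1 = V.1 := congrArg Subtype.val hWs
  have hP : ∀ b ∈ StarAlgebra.adjoin ℂ (Set.range (RepProd.ofFun φ) ∪ {RepProd.ofUnitary φ}),
      P b := by
    intro b hb
    induction hb using StarAlgebra.adjoin_induction with
    | mem x hx =>
      rcases hx with ⟨f, rfl⟩ | rfl
      · change RepProd.ofFun φ f = RepProd.ofFun φ (phaseFun g (-t)) * RepProd.ofFun φ f *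
          RepProd.ofFun φ (phaseFun g t)
        rw [← map_mul, ← map_mul, mul_right_comm, ← phaseFun_add]
        simp [phaseFun_zero]
      · have h := congrArg Subtype.val
          (CrossedProduct.conj_U φ (phaseFun g (-t)) (phaseFun g t))
        refine Eq.trans ?_ h.symm
        change RepProd.ofUnitary φ * RepProd.ofFun φ _ =
          RepProd.ofUnitary φ * RepProd.ofFun φ _
        congr 2
        ext x
        simp only [phaseFun, ContinuousMap.coe_mk, ContinuousMap.mul_apply,
          ContinuousMap.comp_apply, ← Complex.exp_add]
        congr 1
        simp
        ring
    | algebraMap c =>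
      simp only [P, AlgHomClass.commutes]
      rw [← Algebra.commutes, mul_assoc, hVW', mul_one]
    | add x y _ _ hx hy => simp only [P, _root_.map_add] at *; rw [hx, hy]; noncomm_ring
    | mul x y _ _ hx hy =>
      simp only [P, _root_.map_mul] at *
      rw [hx, hy]
      calc V.1 * x * W.1 * (V.1 * y * W.1) = V.1 * x * (W.1 * V.1) * y * W.1 := by
            simp only [mul_assoc]
        _ = _ := by rw [hWV', mul_one]; simp only [mul_assoc]
    | star x _ hx =>
      simp only [P, StarHomClass.map_star] at *
      rw [hx]; simp only [star_mul, hVs', hWs', mul_assoc]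
  have hclosed : IsClosed {b | P b} :=
    isClosed_eq (map_continuous (RepProd.twist φ _ t)) (by fun_prop)
  apply Subtype.ext
  exact hclosed.closure_subset_iff.2 hP a.2

theorem potentialFlow_isApproximatelyInner {X : Type u} [TopologicalSpace X] [CompactSpace X]
    (φ : X ≃ₜ X) (F : C(X, ℝ)) (g : ℕ → C(X, ℝ))
    (hg : Filter.Tendsto (fun n => g n - (g n).comp (φ : C(X, X))) Filter.atTop (nhds F)) :
    (potentialFlow φ F).IsApproximatelyInner := by
  refine ⟨fun n => potentialFlow φ (g n - (g n).comp (φ : C(X, X))),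
    fun n => potentialFlow_isInner_of_coboundary φ (g n), fun a K hK => ?_⟩
  -- Currying makes the potential a continuous parameter with values in functions of time under the
  -- compact-open topology.
  let H : C(C(X, ℝ) × ℝ, CrossedProduct φ) := ⟨_, continuous_potentialFlow_apply φ a⟩
  have := (H.curry.continuous.tendsto F).comp hg
  exact ContinuousMap.tendsto_iff_forall_isCompact_tendstoUniformlyOn.1 this K hK

/-! ### Slowly varying functions with prescribed values along orbits -/

open scoped NNReal in
/-- Trapezoidal cut-off on `ℤ`: equal to `1` for `|j| ≤ N` and to `0` for `|j| ≥ 2N`, with slope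
`1/N` in between. -/
def trapezoid (N : ℕ) (j : ℤ) : ℝ≥0 := Real.toNNReal (min 1 (2 - |(j : ℝ)| / N))

theorem trapezoid_le_one (N : ℕ) (j : ℤ) : trapezoid N j ≤ 1 := by
  rw [trapezoid, Real.toNNReal_le_one]; exact min_le_left _ _

theorem trapezoid_eq_one {N : ℕ} (hN : 0 < N) {j : ℤ} (hj : |j| ≤ N) : trapezoid N j = 1 := by
  have hN' : (0 : ℝ) < N := by exact_mod_cast hN
  have hj' : |(j : ℝ)| ≤ N := by exact_mod_cast hj
  have : |(j : ℝ)| / N ≤ 1 := (div_le_one hN').2 hj'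
  rw [trapezoid, min_eq_left (by linarith), Real.toNNReal_one]

theorem trapezoid_eq_zero {N : ℕ} (hN : 0 < N) {j : ℤ} (hj : 2 * (N : ℤ) ≤ |j|) :
    trapezoid N j = 0 := by
  have hN' : (0 : ℝ) < N := by exact_mod_cast hN
  have hj' : 2 * (N : ℝ) ≤ |(j : ℝ)| := by exact_mod_cast hj
  have : 2 ≤ |(j : ℝ)| / N := (le_div_iff₀ hN').2 hj'
  rw [trapezoid, Real.toNNReal_eq_zero]
  exact (min_le_right _ _).trans (by linarith)

theorem trapezoid_le_add {N : ℕ} (hN : 0 < N) {i j : ℤ} (hij : |i - j| ≤ 1) :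
    trapezoid N i ≤ trapezoid N j + (N : NNReal)⁻¹ := by
  have hN' : (0 : ℝ) < N := by exact_mod_cast hN
  have h1 : |(i : ℝ) - j| ≤ 1 := by exact_mod_cast hij
  have h2 : |(j : ℝ)| - |(i : ℝ)| ≤ 1 := by
    have := abs_sub_abs_le_abs_sub (j : ℝ) i
    rw [abs_sub_comm] at this
    linarith
  have h3 : |(j : ℝ)| / N ≤ |(i : ℝ)| / N + (N : ℝ)⁻¹ := by
    rw [inv_eq_one_div, ← add_div]
    gcongr
    linarith
  have h4 : (N : NNReal)⁻¹ = Real.toNNReal ((N : ℝ)⁻¹) := by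
    rw [Real.toNNReal_inv]; simp
  rw [h4]
  refine le_trans (Real.toNNReal_le_toNNReal ?_) Real.toNNReal_add_le
  have : 0 < (N : ℝ)⁻¹ := by positivity
  rw [← min_add_add_right]
  exact min_le_min (by linarith) (by linarith)

/-- A continuous function which follows a prescribed trapezoidal profile along long pieces of the
orbits of finitely many points, and varies slowly under `φ` everywhere. -/
theorem exists_slowly_varying {X : Type u} [MetricSpace X] (φ : X ≃ₜ X) {q : ℕ} (x : Fin q → X)
    (hx : ∀ p, x p ∉ Function.periodicPts φ)
    (hdisj : ∀ p p' : Fin q, p ≠ p' → Disjoint (homeoOrbit φ (x p)) (homeoOrbit φ (x p')))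
    (a : Fin q → NNReal) (c : NNReal) (hac : ∀ p, a p ≤ c) {N : ℕ} (hN : 0 < N) (M : ℕ) :
    ∃ G : C(X, ℝ), (∀ y, 0 ≤ G y) ∧ (∀ y, G y ≤ c) ∧ (∀ y, |G y - G (φ y)| ≤ c / N) ∧
      ∀ (p : Fin q) (n : ℤ), |n| ≤ M → G ((φ ^ n) (x p)) = a p * trapezoid N n := by
  -- Times `|n| ≤ M` are compared with plateau indices `|j| ≤ 2N`, so differences up to `M + 2N`
  -- matter. Aperiodicity and disjointness leave finitely many positive distances to bound below.
  obtain ⟨δ, hδ, hsep⟩ : ∃ δ > 0, ∀ (p p' : Fin q) (m : ℤ), |m| ≤ M + 2 * N →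
      ¬ (p = p' ∧ m = 0) → δ ≤ dist ((φ ^ m) (x p')) (x p) := by
    have h : ∀ᶠ δ in nhdsWithin (0 : ℝ) (Set.Ioi 0), ∀ p p' : Fin q,
        ∀ m ∈ Finset.Icc (-(M + 2 * N) : ℤ) (M + 2 * N), ¬ (p = p' ∧ m = 0) →
          δ ≤ dist ((φ ^ m) (x p')) (x p) := by
      rw [Filter.eventually_all]; intro p
      rw [Filter.eventually_all]; intro p'
      rw [Filter.eventually_all_finset]; intro m _
      rw [Filter.eventually_imp_distrib_left]; intro hpm
      refine Filter.Eventually.filter_mono nhdsWithin_le_nhds (eventually_le_nhds ?_)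
      rw [dist_pos]
      intro heq
      have hpp : p = p' := by
        by_contra hne
        exact Set.disjoint_left.1 (hdisj p p' hne)
          (show x p ∈ homeoOrbit φ (x p) from ⟨0, by simp⟩) ⟨m, heq⟩
      subst hpp
      exact hpm ⟨rfl, homeo_zpow_injective φ (x p) (hx p) (by simpa using heq)⟩
    obtain ⟨δ, h1, h2⟩ := (h.and self_mem_nhdsWithin).exists
    refine ⟨δ, h2, fun p p' m hm => h1 p p' m ?_⟩
    rw [Finset.mem_Icc]
    exact abs_le.1 hm
  let h : Fin q → X → NNReal := fun p y => Real.toNNReal (1 - dist y (x p) / δ)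
  have h_le : ∀ p y, h p y ≤ 1 := by
    intro p y
    simp only [h, Real.toNNReal_le_one]
    have : 0 ≤ dist y (x p) / δ := by positivity
    linarith
  let T : Fin q × ℤ → X → NNReal := fun i y => a i.1 * trapezoid N i.2 * h i.1 ((φ ^ (-i.2)) y)
  let I : Finset (Fin q × ℤ) := Finset.univ ×ˢ Finset.Icc (-(2 * N) : ℤ) (2 * N)
  -- A supremum of translated bumps, rather than a sum: overlapping bumps away from the chosen
  -- orbits then cost nothing in the bounds by `c` and `c / N`.
  let G : X → NNReal := fun y => I.sup fun i => T i y
  have hTG : ∀ i y, T i y ≤ G y := by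
    intro i y
    by_cases hi : |i.2| ≤ 2 * N
    · refine Finset.le_sup (f := fun i => T i y) ?_
      simp only [I, Finset.mem_product, Finset.mem_univ, true_and, Finset.mem_Icc]
      exact abs_le.1 hi
    · simp [T, trapezoid_eq_zero hN (not_le.1 hi).le]
  -- Moving the point by `φ^e` amounts to reindexing `j` to `j + e`, which leaves the bump values
  -- unchanged and changes the trapezoid by at most `1/N`.
  have hshift : ∀ (e : ℤ) (_ : |e| ≤ 1) (y : X), G y ≤ G ((φ ^ e) y) + c * (N : NNReal)⁻¹ := by
    intro e he y
    refine Finset.sup_le fun i _ => ?_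
    refine le_trans ?_ (add_le_add_left (hTG (i.1, i.2 + e) _) _)
    simp only [T]
    rw [← Homeomorph.mul_apply, ← zpow_add, neg_add, neg_add_cancel_right]
    calc a i.1 * trapezoid N i.2 * h i.1 ((φ ^ (-i.2)) y)
        ≤ a i.1 * (trapezoid N (i.2 + e) + (N : NNReal)⁻¹) * h i.1 ((φ ^ (-i.2)) y) := by
          gcongr
          exact trapezoid_le_add hN (by simpa using he)
      _ = a i.1 * trapezoid N (i.2 + e) * h i.1 ((φ ^ (-i.2)) y) +
          a i.1 * (N : NNReal)⁻¹ * h i.1 ((φ ^ (-i.2)) y) := by ring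
      _ ≤ _ := by
          refine add_le_add_right ?_ _
          calc a i.1 * (N : NNReal)⁻¹ * h i.1 ((φ ^ (-i.2)) y) ≤ c * (N : NNReal)⁻¹ * 1 := by
                gcongr
                · exact hac _
                · exact h_le _ _
            _ = _ := mul_one _
  have hGcont : Continuous G := by
    refine Continuous.finset_sup_apply fun i _ => ?_
    have : Continuous fun y => (φ ^ (-i.2)) y := (φ ^ (-i.2)).continuous
    simp only [T, h]
    fun_prop
  refine ⟨⟨fun y => (G y : ℝ), by fun_prop⟩, fun y => NNReal.coe_nonneg _, fun y => ?_,
    fun y => ?_, fun p n hn => ?_⟩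
  · simp only [ContinuousMap.coe_mk, NNReal.coe_le_coe]
    refine Finset.sup_le fun i _ => ?_
    calc T i y ≤ c * 1 * 1 := by
          simp only [T]
          gcongr
          · exact hac _
          · exact trapezoid_le_one _ _
          · exact h_le _ _
      _ = c := by simp
  · have h1 := hshift 1 (by simp) y
    have h2 := hshift (-1) (by simp) (φ y)
    simp only [zpow_one, zpow_neg_one] at h1 h2
    rw [show (φ⁻¹ : X ≃ₜ X) (φ y) = y from φ.symm_apply_apply y] at h2
    rw [← NNReal.coe_le_coe] at h1 h2
    push_cast at h1 h2
    simp only [ContinuousMap.coe_mk, div_eq_mul_inv]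
    rw [abs_le]
    constructor <;> linarith
  · simp only [ContinuousMap.coe_mk]
    rw [← NNReal.coe_mul, NNReal.coe_inj]
    apply le_antisymm
    · refine Finset.sup_le fun i hi => ?_
      simp only [I, Finset.mem_product, Finset.mem_univ, true_and, Finset.mem_Icc] at hi
      -- At `φ^n (x p)` only the bump with index `(p, n)` can be nonzero, by the choice of `δ`.
      by_cases hpi : i.1 = p ∧ -i.2 + n = 0
      · obtain ⟨h1, h2⟩ := hpi
        have h3 : i.2 = n := by omega
        simp only [T, h1, h3]
        exact mul_le_of_le_one_right' (h_le _ _)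
      · have h0 : h i.1 ((φ ^ (-i.2)) ((φ ^ n) (x p))) = 0 := by
          rw [← Homeomorph.mul_apply, ← zpow_add]
          simp only [h, Real.toNNReal_eq_zero]
          have := hsep i.1 p (-i.2 + n) (by rw [abs_le] at *; omega) hpi
          have := (one_le_div hδ).2 this
          linarith
        simp only [T, h0, mul_zero, zero_le]
    · have := hTG (p, n) ((φ ^ n) (x p))
      simp only [T] at this
      rw [← Homeomorph.mul_apply, ← zpow_add, neg_add_cancel, zpow_zero] at this
      simpa [h] using this

/-! ### Summability tests by blocks of integers -/

/-- Passing from `[-2N_k, 2N_k]` to the next such interval adds at most `4 N_{k+1} + 1 ≤ 5 N_{k+1}`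
terms, each at most `u k`, so finite sums stay bounded. -/
theorem summable_of_block_bound {f : ℤ → ℝ} (hf : ∀ n, 0 ≤ f n) {N : ℕ → ℕ}
    (hN : ∀ k, 0 < N k) (hN4 : ∀ k, 4 * N k ≤ N (k + 1)) {u : ℕ → ℝ}
    (hu : Summable fun k => (N (k + 1) : ℝ) * u k)
    (hfu : ∀ (k : ℕ) (n : ℤ), 2 * (N k : ℤ) ≤ |n| → |n| ≤ 2 * (N (k + 1) : ℤ) → f n ≤ u k) :
    Summable f := by
  have hmono : StrictMono N := strictMono_nat_of_lt_succ fun k => by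
    have := hN k; have := hN4 k; omega
  have hu0 : ∀ k, 0 ≤ u k := fun k =>
    (hf (2 * N k)).trans (hfu k _ (le_abs_self _) (by
      rw [abs_of_nonneg (by positivity)]; have : N k < N (k + 1) := hmono k.lt_succ_self; omega))
  let I : ℕ → Finset ℤ := fun k => Finset.Icc (-(2 * N k : ℤ)) (2 * N k)
  have hI : ∀ k, ∑ n ∈ I k, f n ≤ ∑ n ∈ I 0, f n +
      ∑ i ∈ Finset.range k, 5 * ((N (i + 1) : ℝ) * u i) := by
    intro k
    induction k with
    | zero => simp
    | succ k ih =>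
      have hsub : I k ⊆ I (k + 1) := by
        have : N k < N (k + 1) := hmono k.lt_succ_self
        refine Finset.Icc_subset_Icc ?_ ?_ <;> omega
      rw [← Finset.sum_sdiff hsub, Finset.sum_range_succ, ← add_assoc, add_comm]
      refine add_le_add ih ?_
      calc ∑ n ∈ I (k + 1) \ I k, f n ≤ ∑ n ∈ I (k + 1) \ I k, u k := by
            refine Finset.sum_le_sum fun n hn => ?_
            rw [Finset.mem_sdiff, Finset.mem_Icc, Finset.mem_Icc] at hn
            exact hfu k n (not_lt.1 fun h => hn.2 (abs_le.1 h.le)) (abs_le.2 hn.1)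
        _ ≤ ∑ n ∈ I (k + 1), u k :=
            Finset.sum_le_sum_of_subset_of_nonneg Finset.sdiff_subset fun _ _ _ => hu0 k
        _ ≤ 5 * (N (k + 1) * u k) := by
            rw [Finset.sum_const, nsmul_eq_mul, ← mul_assoc]
            refine mul_le_mul_of_nonneg_right ?_ (hu0 k)
            have hc : (I (k + 1)).card ≤ 5 * N (k + 1) := by
              have := hN (k + 1)
              simp only [I, Int.card_Icc]; omega
            exact_mod_cast hc
  refine summable_of_sum_le (c := ∑ n ∈ I 0, f n + ∑' i, 5 * ((N (i + 1) : ℝ) * u i)) hf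
    fun t => ?_
  have hk : ∃ k, t ⊆ I k := by
    obtain ⟨k, hk⟩ : ∃ k : ℕ, ∀ n ∈ t, n.natAbs ≤ k :=
      ⟨t.sup Int.natAbs, fun n hn => Finset.le_sup (f := Int.natAbs) hn⟩
    refine ⟨k, fun n hn => ?_⟩
    have h1 := hk n hn
    have h2 := hmono.id_le k
    simp only [id] at h2
    rw [Finset.mem_Icc]; omega
  obtain ⟨k, hk⟩ := hk
  refine (Finset.sum_le_sum_of_subset_of_nonneg hk fun n _ _ => hf n).trans ((hI k).trans ?_)
  gcongr
  refine (hu.mul_left 5).sum_le_tsum _ fun i _ => ?_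
  have := hu0 i
  positivity

/-- Since `4 N_k ≤ N_{k+1}`, the positive integers in `(2N_k, N_{k+1}]` number at least `N_{k+1} /
2`. The sum over them is at least `1/2` for arbitrarily late blocks, contradicting the Cauchy
criterion. -/
theorem not_summable_of_block_bound {f : ℤ → ℝ} {N : ℕ → ℕ}
    (hN : ∀ k, 0 < N k) (hN4 : ∀ k, 4 * N k ≤ N (k + 1)) (k₀ : ℕ)
    (hfu : ∀ k ≥ k₀, ∀ n : ℤ, 2 * (N k : ℤ) ≤ |n| → |n| ≤ N (k + 1) → 1 ≤ N (k + 1) * f n) :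
    ¬ Summable f := by
  intro hf
  have hmono : StrictMono N := strictMono_nat_of_lt_succ fun k => by
    have := hN k; have := hN4 k; omega
  obtain ⟨s, hs⟩ := summable_iff_vanishing_norm.1 hf (1 / 2) (by norm_num)
  obtain ⟨m, hm⟩ : ∃ k : ℕ, ∀ n ∈ s, n.natAbs ≤ k :=
    ⟨s.sup Int.natAbs, fun n hn => Finset.le_sup (f := Int.natAbs) hn⟩
  set k := max m k₀
  have hNpos : (0 : ℝ) < N (k + 1) := by exact_mod_cast hN (k + 1)
  have h1 := hs (Finset.Ioc (2 * (N k : ℤ)) (N (k + 1))) (by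
    rw [Finset.disjoint_left]
    intro n hn hns
    rw [Finset.mem_Ioc] at hn
    have h1 := hm n hns
    have h2 := hmono.id_le k
    have h3 : m ≤ k := le_max_left _ _
    simp only [id] at h2
    omega)
  have h2 : ∑ n ∈ Finset.Ioc (2 * (N k : ℤ)) (N (k + 1)), (1 / (N (k + 1) : ℝ)) ≤
      ∑ n ∈ Finset.Ioc (2 * (N k : ℤ)) (N (k + 1)), f n := by
    refine Finset.sum_le_sum fun n hn => ?_
    rw [Finset.mem_Ioc] at hn
    rw [div_le_iff₀' hNpos]
    have h0 : 0 ≤ n := by omega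
    exact hfu k (le_max_right _ _) n (by rw [abs_of_nonneg h0]; omega)
      (by rw [abs_of_nonneg h0]; omega)
  have h3 : (1 / 2 : ℝ) ≤
      ∑ n ∈ Finset.Ioc (2 * (N k : ℤ)) (N (k + 1)), (1 / (N (k + 1) : ℝ)) := by
    rw [Finset.sum_const, nsmul_eq_mul, mul_one_div, div_le_div_iff₀ (by norm_num) hNpos]
    have : N (k + 1) ≤ (Finset.Ioc (2 * (N k : ℤ)) (N (k + 1))).card * 2 := by
      have := hN4 k
      rw [Int.card_Ioc]; omega
    rw [one_mul]
    exact_mod_cast this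
  rw [Real.norm_eq_abs] at h1
  linarith [le_abs_self (∑ n ∈ Finset.Ioc (2 * (N k : ℤ)) (N (k + 1)), f n)]

/-! ### The scales -/

/-- Rapidly growing scales: heights `b k`, lengths `N (k + 1) ≈ exp (b k)`, and `B k`, which
dominates the contribution of all heights before the `k`-th. -/
structure Scales (Γ : ℝ) where
  B : ℕ → ℝ
  b : ℕ → ℝ
  N : ℕ → ℕ
  le_B : ∀ k : ℕ, (k : ℝ) + 1 ≤ B k
  B_succ : ∀ k, B (k + 1) = B k + 2 * Γ * b k
  b_eq : ∀ k : ℕ, b k = 2 * ((k : ℝ) + 1) ^ 2 * B k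
  N_pos : ∀ k, 0 < N k
  four_mul_N_le : ∀ k, 4 * N k ≤ N (k + 1)
  exp_le_N : ∀ k, Real.exp (b k) ≤ N (k + 1)
  N_le_exp : ∀ k, N (k + 1) ≤ 2 * Real.exp (b k)
  summable_b_div_N : Summable fun k => b k / N k

/-- `B` is defined by recursion, `b` from `B`, and `N` by rounding up `exp b`. Each `b (k + 1)` is
at most quadratic in `b k` whereas `N (k + 1)` is exponential in it, which makes `b k / N k`
summable. -/
theorem nonempty_scales {Γ : ℝ} (hΓ : 1 ≤ Γ) : Nonempty (Scales Γ) := by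
  let B : ℕ → ℝ := fun k => Nat.rec 1 (fun k x => x + 2 * Γ * (2 * ((k : ℝ) + 1) ^ 2 * x)) k
  let b : ℕ → ℝ := fun k => 2 * ((k : ℝ) + 1) ^ 2 * B k
  obtain ⟨N, hN0, hNs⟩ : ∃ N : ℕ → ℕ, N 0 = 1 ∧ ∀ k, N (k + 1) = ⌈Real.exp (b k)⌉₊ :=
    ⟨fun k => Nat.casesOn k 1 fun k => ⌈Real.exp (b k)⌉₊, rfl, fun _ => rfl⟩
  have hBs : ∀ k, B (k + 1) = B k + 2 * Γ * b k := fun k => rfl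
  have hb : ∀ k : ℕ, b k = 2 * ((k : ℝ) + 1) ^ 2 * B k := fun k => rfl
  have hBk : ∀ k : ℕ, (k : ℝ) + 1 ≤ B k := by
    intro k
    induction k with
    | zero => simp [B]
    | succ k ih =>
      rw [hBs, hb]; push_cast
      have hk : (0 : ℝ) ≤ k := k.cast_nonneg
      have h1 : 1 ≤ B k := by linarith
      have h2 : (1 : ℝ) ≤ ((k : ℝ) + 1) ^ 2 := one_le_pow₀ (by linarith)
      have h3 : 1 ≤ ((k : ℝ) + 1) ^ 2 * B k := one_le_mul_of_one_le_of_one_le h2 h1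
      have h4 : 1 ≤ Γ * (((k : ℝ) + 1) ^ 2 * B k) := one_le_mul_of_one_le_of_one_le hΓ h3
      linarith
  have hb2 : ∀ k : ℕ, 2 * ((k : ℝ) + 1) ^ 2 ≤ b k := by
    intro k
    have hk : (0 : ℝ) ≤ k := k.cast_nonneg
    exact le_mul_of_one_le_right (by positivity) (by linarith [hBk k])
  have hb2' : ∀ k : ℕ, 2 ≤ b k := by
    intro k
    have hk : (0 : ℝ) ≤ k := k.cast_nonneg
    have h2 : (1 : ℝ) ≤ ((k : ℝ) + 1) ^ 2 := one_le_pow₀ (by linarith)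
    linarith [hb2 k]
  -- Rounding up costs a factor at most `2`, so `N (k + 2) ≥ 4 N (k + 1)` needs `exp b` to grow by a
  -- factor `8`; adding `8` to the exponent suffices.
  have hbs : ∀ k, b k + 8 ≤ b (k + 1) := by
    intro k
    have hk : (0 : ℝ) ≤ k := k.cast_nonneg
    have h1 : 1 ≤ B k := by linarith [hBk k]
    have h0 := hb2' k
    have h3 : 2 ≤ Γ * b k := by nlinarith
    have h4 : b (k + 1) = 2 * ((k : ℝ) + 2) ^ 2 * (B k + 2 * Γ * b k) := by
      rw [hb, hBs]; push_cast; ring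
    have h5 : (4 : ℝ) ≤ ((k : ℝ) + 2) ^ 2 := by nlinarith
    have h6 : b k ≤ 2 * ((k : ℝ) + 2) ^ 2 * B k := by rw [hb]; gcongr; norm_num
    nlinarith
  have hexpN : ∀ k, Real.exp (b k) ≤ N (k + 1) := fun k => by
    rw [hNs]; exact Nat.le_ceil _
  have hNexp : ∀ k, N (k + 1) ≤ 2 * Real.exp (b k) := by
    intro k
    have h1 : (N (k + 1) : ℝ) < Real.exp (b k) + 1 := by
      rw [hNs]; exact Nat.ceil_lt_add_one (Real.exp_pos _).le
    have h2 : 1 ≤ Real.exp (b k) := Real.one_le_exp (by linarith [hb2' k])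
    linarith
  have hNpos : ∀ k, 0 < N k := by
    intro k
    cases k with
    | zero => rw [hN0]; exact one_pos
    | succ k => exact_mod_cast (Real.exp_pos (b k)).trans_le (hexpN k)
  have hN4 : ∀ k, 4 * N k ≤ N (k + 1) := by
    intro k
    have : (4 : ℝ) * (N k : ℝ) ≤ (N (k + 1) : ℝ) := by
      refine le_trans ?_ (hexpN k)
      cases k with
      | zero =>
        have h := Real.quadratic_le_exp_of_nonneg (x := b 0) (by linarith [hb2' 0])
        have h2 := hb2' 0
        rw [hN0, Nat.cast_one]
        nlinarith
      | succ k =>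
        have h1 := hNexp k
        have h2 := Real.exp_le_exp.2 (hbs k)
        rw [Real.exp_add] at h2
        have h3 : 8 ≤ Real.exp 8 := by linarith [Real.add_one_le_exp (8 : ℝ)]
        have h4 := Real.exp_pos (b k)
        nlinarith
    exact_mod_cast this
  refine ⟨B, b, N, hBk, hBs, hb, hNpos, hN4, hexpN, hNexp, ?_⟩
  rw [← summable_nat_add_iff 1]
  -- `480 = 20 * 4!`, from `b (k + 1) ≤ 20 Γ (b k)^2` and `N (k + 1) ≥ (b k)^4 / 4!`; then `b k ≥ k
  -- + 1` finishes the comparison.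
  have hsum : Summable fun k : ℕ => 480 * Γ * (1 / (((k + 1 : ℕ) : ℝ)) ^ 2) :=
    ((summable_nat_add_iff 1).2 (Real.summable_one_div_nat_pow.2 one_lt_two)).mul_left _
  refine Summable.of_nonneg_of_le (fun k => ?_) (fun k => ?_) hsum
  · have := hb2' (k + 1)
    positivity
  have hk : (0 : ℝ) ≤ k := k.cast_nonneg
  set m : ℝ := (k : ℝ) + 1 with hm
  have hm1 : 1 ≤ m := by linarith
  have hbk : 2 * m ^ 2 ≤ b k := hb2 k
  have hb0 : 0 < b k := by linarith [hb2' k]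
  have hB : B k ≤ b k := by
    rw [hb]
    have : 1 ≤ B k := by linarith [hBk k]
    have : 1 ≤ m ^ 2 := one_le_pow₀ hm1
    nlinarith
  have h1 : b (k + 1) ≤ 20 * Γ * b k ^ 2 := by
    have e : b (k + 1) = 2 * (m + 1) ^ 2 * (B k + 2 * Γ * b k) := by
      rw [hb, hBs, hm]; push_cast; ring
    have e1 : (m + 1) ^ 2 ≤ 2 * b k := by nlinarith
    have e2 : B k + 2 * Γ * b k ≤ 3 * Γ * b k := by nlinarith
    rw [e]
    calc 2 * (m + 1) ^ 2 * (B k + 2 * Γ * b k) ≤ 2 * (2 * b k) * (3 * Γ * b k) := by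
          have : 0 ≤ B k + 2 * Γ * b k := by
            have : 0 ≤ B k := by linarith [hBk k]
            positivity
          gcongr
      _ ≤ _ := by nlinarith [mul_pos (by linarith : 0 < Γ) (pow_pos hb0 2)]
  have h2 : b k ^ 4 / 24 ≤ N (k + 1) := by
    have := Real.pow_div_factorial_le_exp (b k) hb0.le 4
    norm_num [Nat.factorial] at this
    exact this.trans (hexpN k)
  have hb4 : 0 < b k ^ 4 / 24 := by positivity
  calc b (k + 1) / N (k + 1) ≤ 20 * Γ * b k ^ 2 / (b k ^ 4 / 24) :=
        div_le_div₀ (by positivity) h1 hb4 h2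
    _ = 480 * Γ * (1 / b k ^ 2) := by field_simp; norm_num
    _ ≤ 480 * Γ * (1 / (((k + 1 : ℕ) : ℝ)) ^ 2) := by
        have : m ≤ b k := by nlinarith
        push_cast
        gcongr

theorem Scales.strictMono_N {Γ : ℝ} (S : Scales Γ) : StrictMono S.N :=
  strictMono_nat_of_lt_succ fun k => by
    have := S.N_pos k; have := S.four_mul_N_le k; omega

theorem Scales.B_pos {Γ : ℝ} (S : Scales Γ) (k : ℕ) : 0 < S.B k :=
  lt_of_lt_of_le (by positivity) (S.le_B k)

theorem Scales.b_pos {Γ : ℝ} (S : Scales Γ) (k : ℕ) : 0 < S.b k := by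
  have := S.B_pos k
  rw [S.b_eq]; positivity

/-- As `N (k + 1) ≤ 2 exp (b k)`, the `k`-th block contributes at most a constant times `exp (b k -
t (a k - B k))`, and the last hypothesis makes this geometrically small. -/
theorem Scales.summable_exp {Γ : ℝ} (S : Scales Γ) {s : ℤ → ℝ} {a : ℕ → ℝ}
    (hs : ∀ (k : ℕ) (n : ℤ), 2 * (S.N k : ℤ) ≤ |n| → |n| ≤ 2 * (S.N (k + 1) : ℤ) →
      a k - S.B k ≤ s n) {t : ℝ} (ht : 0 ≤ t) (k₀ : ℕ)
    (hk₀ : ∀ k ≥ k₀, S.b k - t * (a k - S.B k) ≤ -k) :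
    Summable fun n => Real.exp (-t * s n) := by
  refine summable_of_block_bound (N := fun k => S.N (k + k₀))
    (u := fun k => Real.exp (-t * (a (k + k₀) - S.B (k + k₀)))) (fun n => (Real.exp_pos _).le)
    (fun k => S.N_pos _) (fun k => ?_) ?_ fun k n h1 h2 => ?_
  · rw [add_right_comm]; exact S.four_mul_N_le _
  · refine Summable.of_nonneg_of_le (fun k => by positivity) (fun k => ?_)
      (Real.summable_exp_neg_nat.mul_left 2)
    calc (S.N (k + 1 + k₀) : ℝ) * Real.exp (-t * (a (k + k₀) - S.B (k + k₀)))
        ≤ 2 * Real.exp (S.b (k + k₀)) * Real.exp (-t * (a (k + k₀) - S.B (k + k₀))) := by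
          gcongr
          rw [add_right_comm]
          exact S.N_le_exp _
      _ = 2 * Real.exp (S.b (k + k₀) - t * (a (k + k₀) - S.B (k + k₀))) := by
          rw [mul_assoc, ← Real.exp_add]; ring_nf
      _ ≤ 2 * Real.exp (-k) := by
          have := hk₀ (k + k₀) (by omega)
          push_cast at this
          gcongr
          linarith [(k₀.cast_nonneg : (0 : ℝ) ≤ k₀)]
  · have h2' : |n| ≤ 2 * (S.N (k + k₀ + 1) : ℤ) := by rw [add_right_comm]; exact h2
    have := hs _ n h1 h2'
    rw [Real.exp_le_exp]
    nlinarith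

/-- As `exp (b k) ≤ N (k + 1)`, a nonnegative exponent `b k - t (a k + B k)` forces each weight in
the block to be at least `1 / N (k + 1)`. -/
theorem Scales.not_summable_exp {Γ : ℝ} (S : Scales Γ) {s : ℤ → ℝ} {a : ℕ → ℝ}
    (hs : ∀ (k : ℕ) (n : ℤ), 2 * (S.N k : ℤ) ≤ |n| → |n| ≤ (S.N (k + 1) : ℤ) →
      s n ≤ a k + S.B k) {t : ℝ} (ht : 0 ≤ t) (k₀ : ℕ)
    (hk₀ : ∀ k ≥ k₀, 0 ≤ S.b k - t * (a k + S.B k)) :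
    ¬ Summable fun n => Real.exp (-t * s n) := by
  refine not_summable_of_block_bound S.N_pos S.four_mul_N_le k₀ fun k hk n h1 h2 => ?_
  calc 1 ≤ Real.exp (S.b k - t * (a k + S.B k)) := Real.one_le_exp (hk₀ k hk)
    _ = Real.exp (S.b k) * Real.exp (-t * (a k + S.B k)) := by
        rw [← Real.exp_add]; ring_nf
    _ ≤ S.N (k + 1) * Real.exp (-t * s n) := by
        have := hs k n h1 h2
        gcongr ?_ * Real.exp ?_
        · exact S.exp_le_N k
        · nlinarith

theorem Scales.not_summable_exp_of_nonneg {Γ : ℝ} (S : Scales Γ) {s : ℤ → ℝ} {a : ℕ → ℝ}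
    (hs : ∀ (k : ℕ) (n : ℤ), 2 * (S.N k : ℤ) ≤ |n| → |n| ≤ 2 * (S.N (k + 1) : ℤ) →
      a k - S.B k ≤ s n) {β : ℝ} (hβ : 0 ≤ β) (k₀ : ℕ) (hk₀ : ∀ k ≥ k₀, S.B k ≤ a k) :
    ¬ Summable fun n => Real.exp (β * s n) := by
  refine not_summable_of_block_bound S.N_pos S.four_mul_N_le k₀ fun k hk n h1 h2 => ?_
  have h3 := hs k n h1 (by omega)
  have h4 := hk₀ k hk
  have h5 : (1 : ℝ) ≤ S.N (k + 1) := by exact_mod_cast S.N_pos (k + 1)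
  exact one_le_mul_of_one_le_of_one_le h5 (Real.one_le_exp (mul_nonneg hβ (by linarith)))

/-! ### Plateau heights and the critical exponent -/

/-- The height of the `k`-th plateau: asymptotic to `γ * b k`, with a lower order correction
whose sign `σ` decides convergence at the critical exponent. -/
def Scales.height {Γ : ℝ} (S : Scales Γ) (γ σ : ℝ) (k : ℕ) : ℝ :=
  γ * (S.b k + σ * (((k : ℝ) + 1) * S.B k))

theorem Scales.b_eq' {Γ : ℝ} (S : Scales Γ) (k : ℕ) :
    S.b k = 2 * ((k : ℝ) + 1) * (((k : ℝ) + 1) * S.B k) := by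
  rw [S.b_eq]; ring

theorem Scales.height_nonneg {Γ : ℝ} (S : Scales Γ) {γ σ : ℝ} (hγ : 0 ≤ γ) (hσ : -1 ≤ σ) (k : ℕ) :
    0 ≤ S.height γ σ k := by
  have hd : 0 < ((k : ℝ) + 1) * S.B k := mul_pos (by positivity) (S.B_pos k)
  have hk : (0 : ℝ) ≤ k := k.cast_nonneg
  refine mul_nonneg hγ ?_
  rw [S.b_eq']
  nlinarith

theorem Scales.height_le {Γ : ℝ} (S : Scales Γ) {γ σ : ℝ} (hγ : 0 ≤ γ) (hγΓ : γ ≤ Γ) (hσ : σ ≤ 1)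
    (k : ℕ) : S.height γ σ k ≤ 2 * Γ * S.b k := by
  have hd : 0 < ((k : ℝ) + 1) * S.B k := mul_pos (by positivity) (S.B_pos k)
  have hk : (0 : ℝ) ≤ k := k.cast_nonneg
  have hb := S.b_pos k
  have h1 : S.b k + σ * (((k : ℝ) + 1) * S.B k) ≤ 2 * S.b k := by
    have := S.b_eq' k
    nlinarith
  calc S.height γ σ k ≤ γ * (2 * S.b k) := mul_le_mul_of_nonneg_left h1 hγ
    _ ≤ Γ * (2 * S.b k) := by gcongr
    _ = _ := by ring

theorem Scales.eventually_B_le_height {Γ : ℝ} (S : Scales Γ) {γ σ : ℝ} (hγ : 0 < γ)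
    (hσ : -1 ≤ σ) : ∃ k₀ : ℕ, ∀ k ≥ k₀, S.B k ≤ S.height γ σ k := by
  obtain ⟨k₀, hk₀⟩ := exists_nat_ge (1 / γ)
  refine ⟨k₀, fun k hk => ?_⟩
  have hk' : (k₀ : ℝ) ≤ k := by exact_mod_cast hk
  have hB := S.B_pos k
  have hk0 : (0 : ℝ) ≤ k := k.cast_nonneg
  have h1 : 1 ≤ γ * k := by rw [← div_le_iff₀' hγ]; linarith
  have hd : 0 < ((k : ℝ) + 1) * S.B k := mul_pos (by positivity) hB
  have h2 : k * S.B k ≤ S.b k + σ * (((k : ℝ) + 1) * S.B k) := by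
    rw [S.b_eq']; nlinarith
  calc S.B k ≤ γ * k * S.B k := le_mul_of_one_le_left hB.le h1
    _ = γ * (k * S.B k) := by ring
    _ ≤ _ := mul_le_mul_of_nonneg_left h2 hγ.le

/-- With `t = -β` and `d = (k + 1) B_k`, so that `b_k = 2 (k + 1) d`, the exponent of the `k`-th
block is `2 (1 - tγ) (k + 1) d - tγσ d`, up to an error `t B_k`. The first term dominates unless `tγ
= 1`; in that case the sign of `σ` decides, since `k + 1` eventually exceeds `t`. -/
theorem Scales.summable_iff {Γ : ℝ} (S : Scales Γ) {s : ℤ → ℝ} {γ σ : ℝ} (hγ : 0 < γ)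
    (hσ : σ = 1 ∨ σ = -1)
    (hlo : ∀ (k : ℕ) (n : ℤ), 2 * (S.N k : ℤ) ≤ |n| → |n| ≤ 2 * (S.N (k + 1) : ℤ) →
      S.height γ σ k - S.B k ≤ s n)
    (hup : ∀ (k : ℕ) (n : ℤ), 2 * (S.N k : ℤ) ≤ |n| → |n| ≤ (S.N (k + 1) : ℤ) →
      s n ≤ S.height γ σ k + S.B k) (β : ℝ) :
    (Summable fun n => Real.exp (β * s n)) ↔ 1 < -β * γ ∨ (-β * γ = 1 ∧ σ = 1) := by
  have hσ' : -1 ≤ σ ∧ σ ≤ 1 := by rcases hσ with rfl | rfl <;> norm_num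
  rcases le_or_gt 0 β with hβ | hβ
  · obtain ⟨k₀, hk₀⟩ := S.eventually_B_le_height hγ hσ'.1
    refine iff_of_false (S.not_summable_exp_of_nonneg hlo hβ k₀ hk₀) ?_
    have : 0 ≤ β * γ := by positivity
    rintro (h | ⟨h, -⟩) <;> linarith
  obtain ⟨t, rfl⟩ : ∃ t, β = -t := ⟨-β, by ring⟩
  have ht : 0 < t := by linarith
  rw [neg_neg]
  have hexpr : ∀ k, t * S.height γ σ k =
      t * γ * S.b k + t * γ * σ * (((k : ℝ) + 1) * S.B k) := by
    intro k; rw [Scales.height]; ring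
  have hd : ∀ k : ℕ, (k : ℝ) + 1 ≤ ((k : ℝ) + 1) * S.B k ∧ S.B k ≤ ((k : ℝ) + 1) * S.B k := by
    intro k
    have hk : (0 : ℝ) ≤ k := k.cast_nonneg
    have hB := S.le_B k
    constructor <;> nlinarith
  by_cases hc : 1 < t * γ ∨ (t * γ = 1 ∧ σ = 1)
  · refine iff_of_true ?_ hc
    rcases hc with hτ | ⟨hτ, rfl⟩
    · obtain ⟨k₀, hk₀⟩ := exists_nat_ge ((t * γ + t + 1) / (2 * (t * γ - 1)))
      refine S.summable_exp hlo ht.le k₀ fun k hk => ?_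
      have hk' : (k₀ : ℝ) ≤ k := by exact_mod_cast hk
      have h1 : t * γ + t + 1 ≤ 2 * (t * γ - 1) * k := by
        rw [← div_le_iff₀' (by linarith)]; linarith
      obtain ⟨h2, h3⟩ := hd k
      rw [mul_sub, hexpr, S.b_eq']
      set d := ((k : ℝ) + 1) * S.B k
      have hk0 : (0 : ℝ) ≤ k := k.cast_nonneg
      have hd0 : 0 ≤ d := by linarith
      have h4 : -(t * γ * σ * d) ≤ t * γ * d := by nlinarith [mul_nonneg (by linarith : 0 ≤ t * γ) hd0]
      have h5 := mul_le_mul_of_nonneg_right h1 hd0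
      have h6 := mul_le_mul_of_nonneg_left h3 ht.le
      nlinarith
    · obtain ⟨k₀, hk₀⟩ := exists_nat_ge t
      -- At the critical exponent the terms in `b_k` cancel, leaving `(t - (k + 1)) B_k ≤ -B_k ≤ -k`
      -- once `k ≥ t`.
      refine S.summable_exp hlo ht.le k₀ fun k hk => ?_
      have hk' : (k₀ : ℝ) ≤ k := by exact_mod_cast hk
      rw [mul_sub, hexpr, hτ]
      have := S.le_B k
      have hk0 : (0 : ℝ) ≤ k := k.cast_nonneg
      nlinarith
  · refine iff_of_false ?_ hc
    push Not at hc
    rcases hc.1.lt_or_eq with hτ | hτ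
    · obtain ⟨k₀, hk₀⟩ := exists_nat_ge ((t * γ + t) / (2 * (1 - t * γ)))
      refine S.not_summable_exp hup ht.le k₀ fun k hk => ?_
      have hk' : (k₀ : ℝ) ≤ k := by exact_mod_cast hk
      have h1 : t * γ + t ≤ 2 * (1 - t * γ) * k := by
        rw [← div_le_iff₀' (by linarith)]; linarith
      obtain ⟨h2, h3⟩ := hd k
      rw [mul_add, hexpr, S.b_eq']
      set d := ((k : ℝ) + 1) * S.B k
      have hk0 : (0 : ℝ) ≤ k := k.cast_nonneg
      have hd0 : 0 ≤ d := by linarith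
      have h4 : t * γ * σ * d ≤ t * γ * d := by nlinarith [mul_nonneg (mul_pos ht hγ).le hd0]
      have h5 := mul_le_mul_of_nonneg_right h1 hd0
      have h6 := mul_le_mul_of_nonneg_left h3 ht.le
      nlinarith
    · have hσ1 : σ = -1 := hσ.resolve_left (hc.2 hτ)
      obtain ⟨k₀, hk₀⟩ := exists_nat_ge t
      refine S.not_summable_exp hup ht.le k₀ fun k hk => ?_
      have hk' : (k₀ : ℝ) ≤ k := by exact_mod_cast hk
      rw [mul_add, hexpr, hτ, hσ1]
      have := S.B_pos k
      nlinarith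

/-! ### Construction of the potential -/

/-- For a sum of slowly varying functions at the given scales, the Birkhoff sums along the orbits
of the given points grow like prescribed heights. -/
theorem exists_potential {X : Type u} [MetricSpace X] [CompactSpace X] (φ : X ≃ₜ X) {q : ℕ}
    (x : Fin q → X) (hx : ∀ p, x p ∉ Function.periodicPts φ)
    (hdisj : ∀ p p' : Fin q, p ≠ p' → Disjoint (homeoOrbit φ (x p)) (homeoOrbit φ (x p')))
    {Γ : ℝ} (hΓ : 0 ≤ Γ) (S : Scales Γ) (a : Fin q → ℕ → ℝ) (ha0 : ∀ p k, 0 ≤ a p k)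
    (ha : ∀ p k, a p k ≤ 2 * Γ * S.b k) :
    ∃ (F : C(X, ℝ)) (g : ℕ → C(X, ℝ)) (s : Fin q → ℤ → ℝ),
      Filter.Tendsto (fun n => g n - (g n).comp (φ : C(X, X))) Filter.atTop (nhds F) ∧
      (∀ p n, s p (n + 1) = s p n + F ((φ ^ n) (x p))) ∧
      (∀ p (k : ℕ) (n : ℤ), 2 * (S.N k : ℤ) ≤ |n| → |n| ≤ 2 * (S.N (k + 1) : ℤ) →
        a p k - S.B k ≤ s p n) ∧
      (∀ p (k : ℕ) (n : ℤ), 2 * (S.N k : ℤ) ≤ |n| → |n| ≤ (S.N (k + 1) : ℤ) →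
        s p n ≤ a p k + S.B k) := by
  have hc0 : ∀ k, 0 ≤ 2 * Γ * S.b k := fun k => by have := S.b_pos k; positivity
  -- The profile of `G k` is prescribed up to time `2 * S.N (k + 1)`: the zero tail has to last
  -- until every `G i` with `i > k` has reached zero or `G (k + 1)` has taken over.
  have hex := fun k => exists_slowly_varying φ x hx hdisj
    (fun p => ⟨a p k, ha0 p k⟩) ⟨2 * Γ * S.b k, hc0 k⟩ (fun p => ha p k) (S.N_pos k)
    (2 * S.N (k + 1))
  choose G hG0 hGc hGφ hGx using hex
  replace hGc : ∀ k y, G k y ≤ 2 * Γ * S.b k := hGc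
  replace hGx : ∀ (k : ℕ) (p : Fin q) (n : ℤ), |n| ≤ ((2 * S.N (k + 1) : ℕ) : ℤ) →
    G k ((φ ^ n) (x p)) = a p k * trapezoid (S.N k) n := hGx
  have hGx0 : ∀ p k, G k (x p) = a p k := by
    intro p k
    have := hGx k p 0 (by simp)
    rwa [zpow_zero, Homeomorph.one_apply, trapezoid_eq_one (S.N_pos k) (by simp),
      NNReal.coe_one, mul_one] at this
  have hmono := S.strictMono_N
  have hnorm : ∀ k, ‖G k - (G k).comp (φ : C(X, X))‖ ≤ 2 * Γ * (S.b k / S.N k) := by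
    intro k
    have h0 : 0 ≤ 2 * Γ * (S.b k / S.N k) := by have := S.b_pos k; positivity
    refine (ContinuousMap.norm_le _ h0).2 fun y => ?_
    rw [← mul_div_assoc]
    exact hGφ k y
  have hsum : Summable fun k => G k - (G k).comp (φ : C(X, X)) :=
    Summable.of_norm_bounded (S.summable_b_div_N.mul_left (2 * Γ)) hnorm
  set F : C(X, ℝ) := ∑' k, (G k - (G k).comp (φ : C(X, X))) with hF
  have hFy : ∀ y, HasSum (fun k => G k y - G k (φ y)) (F y) := fun y =>
    hsum.hasSum.map (ContinuousMap.evalAlgHom ℝ ℝ y) (continuous_eval_const y)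
  -- The Birkhoff sum of the `k`-th coboundary telescopes to this. It vanishes while `n` is on the
  -- plateau, so for fixed `n` only finitely many `k` contribute.
  let f : Fin q → ℤ → ℕ → ℝ := fun p n k => G k (x p) - G k ((φ ^ n) (x p))
  have hf_zero : ∀ p (n : ℤ) k, |n| ≤ S.N k → f p n k = 0 := by
    intro p n k hn
    have h1 : |n| ≤ ((2 * S.N (k + 1) : ℕ) : ℤ) := by
      have : S.N k < S.N (k + 1) := hmono k.lt_succ_self
      push_cast; omega
    simp only [f]
    rw [hGx k p n h1, trapezoid_eq_one (S.N_pos k) hn, hGx0]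
    simp
  have hf_nonneg : ∀ p (n : ℤ) k, |n| ≤ 2 * S.N (k + 1) → 0 ≤ f p n k := by
    intro p n k hn
    simp only [f]
    rw [hGx k p n (by push_cast; exact hn), hGx0, sub_nonneg]
    exact mul_le_of_le_one_right (ha0 p k) (NNReal.coe_le_one.2 (trapezoid_le_one _ _))
  have hf_eq : ∀ p (n : ℤ) k, 2 * (S.N k : ℤ) ≤ |n| → |n| ≤ 2 * S.N (k + 1) → f p n k = a p k := by
    intro p n k hn hn'
    simp only [f]
    rw [hGx k p n (by push_cast; exact hn'), hGx0, trapezoid_eq_zero (S.N_pos k) hn]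
    simp
  have hf_abs : ∀ p (n : ℤ) k, |f p n k| ≤ 2 * Γ * S.b k := by
    intro p n k
    simp only [f]
    rw [abs_le]
    constructor <;> linarith [hG0 k (x p), hG0 k ((φ ^ n) (x p)), hGc k (x p),
      hGc k ((φ ^ n) (x p))]
  have hf_sum : ∀ p n, Summable (f p n) := by
    intro p n
    refine summable_of_ne_finset_zero (s := Finset.range n.natAbs) fun k hk => hf_zero p n k ?_
    rw [Finset.mem_range, not_lt] at hk
    rw [Int.abs_eq_natAbs]
    have := hmono.id_le k
    simp only [id] at this
    omega
  -- Earlier functions are out of control at time `n`, but each `f p n i` is at most the oscillation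
  -- `2Γ b_i`, and `B k` was built to absorb their sum.
  have hB : ∀ k, ∑ i ∈ Finset.range k, 2 * Γ * S.b i ≤ S.B k := by
    intro k
    induction k with
    | zero => simpa using (S.B_pos 0).le
    | succ k ih => rw [Finset.sum_range_succ, S.B_succ]; linarith
  have hpre : ∀ p n k, |∑ i ∈ Finset.range k, f p n i| ≤ S.B k := fun p n k =>
    (Finset.abs_sum_le_sum_abs _ _).trans
      ((Finset.sum_le_sum fun i _ => hf_abs p n i).trans (hB k))
  refine ⟨F, fun n => ∑ k ∈ Finset.range n, G k, fun p n => ∑' k, f p n k, ?_, ?_, ?_, ?_⟩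
  · refine hsum.hasSum.tendsto_sum_nat.congr fun n => ?_
    ext y
    simp [ContinuousMap.sum_apply]
  · intro p n
    have h := (hf_sum p n).hasSum.add (hFy ((φ ^ n) (x p)))
    rw [← h.tsum_eq]
    refine tsum_congr fun k => ?_
    simp only [f]
    rw [homeo_zpow_add_one_apply]
    ring
  -- Up to `2 N_{k+1}` the later terms may already be positive but never negative, so the lower
  -- bound holds on the whole block. The upper bound needs them to vanish, hence `|n| ≤ N_{k+1}`
  -- there.
  · intro p k n h1 h2
    have h3 := (hf_sum p n).sum_le_tsum (Finset.range (k + 1)) fun i hi => by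
      rw [Finset.mem_range, not_lt] at hi
      refine hf_nonneg p n i (h2.trans ?_)
      have : S.N (k + 1) ≤ S.N (i + 1) := hmono.monotone (by omega)
      omega
    rw [Finset.sum_range_succ, hf_eq p n k h1 h2] at h3
    have := (abs_le.1 (hpre p n k)).1
    linarith
  · intro p k n h1 h2
    change ∑' k, f p n k ≤ _
    rw [tsum_eq_sum (s := Finset.range (k + 1)), Finset.sum_range_succ,
      hf_eq p n k h1 (by omega)]
    · have := (abs_le.1 (hpre p n k)).2
      linarith
    · intro i hi
      rw [Finset.mem_range, not_lt] at hi
      refine hf_zero p n i (h2.trans ?_)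
      exact_mod_cast hmono.monotone hi

end

/-! ### Choice of parameters -/

theorem theorem7p1 {X : Type u} [MetricSpace X] [CompactSpace X] [MeasurableSpace X]
    [BorelSpace X] (φ : X ≃ₜ X) (q : ℕ) (x : Fin q → X)
    (hx : ∀ p, x p ∉ Function.periodicPts φ)
    (hdisj : ∀ p p' : Fin q, p ≠ p' → Disjoint (homeoOrbit φ (x p)) (homeoOrbit φ (x p')))
    (β₀ : Fin q → ℝ) (hβ₀ : ∀ p, β₀ p < 0)
    (J : Fin q → Set ℝ) (hJ : ∀ p, J p = Set.Iic (β₀ p) ∨ J p = Set.Iio (β₀ p)) :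
    ∃ F : C(X, ℝ),
      (∀ (p : Fin q) (β : ℝ),
        (∃ m : MeasureTheory.Measure X,
          IsConformalMeasure φ F β m ∧ IsConcentratedOn m (homeoOrbit φ (x p))) ↔ β ∈ J p) ∧
      (potentialFlow φ F).IsApproximatelyInner := by
  classical
  -- This slope turns the critical equation `-β * γ p = 1` into `β = β₀ p`.
  let γ : Fin q → ℝ := fun p => (-β₀ p)⁻¹
  have hγ : ∀ p, 0 < γ p := fun p => inv_pos.2 (neg_pos.2 (hβ₀ p))
  -- One bound for all slopes lets every orbit share the same scales; the summand `1` keeps `1 ≤ Γ`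
  -- also when `q = 0`.
  let Γ : ℝ := 1 + ∑ p, γ p
  have hΓ : 1 ≤ Γ := le_add_of_nonneg_right (Finset.sum_nonneg fun p _ => (hγ p).le)
  have hγΓ : ∀ p, γ p ≤ Γ := fun p =>
    (Finset.single_le_sum (f := γ) (fun p _ => (hγ p).le) (Finset.mem_univ p)).trans
      (le_add_of_nonneg_left zero_le_one)
  let σ : Fin q → ℝ := fun p => if β₀ p ∈ J p then 1 else -1
  have hσ : ∀ p, σ p = 1 ∨ σ p = -1 := fun p => by
    by_cases h : β₀ p ∈ J p <;> simp [σ, h]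
  have hσ' : ∀ p, -1 ≤ σ p ∧ σ p ≤ 1 := fun p => by
    rcases hσ p with h | h <;> rw [h] <;> norm_num
  obtain ⟨S⟩ := nonempty_scales hΓ
  obtain ⟨F, g, s, hg, hs, hlo, hup⟩ := exists_potential φ x hx hdisj (zero_le_one.trans hΓ) S
    (fun p k => S.height (γ p) (σ p) k) (fun p k => S.height_nonneg (hγ p).le (hσ' p).1 k)
    (fun p k => S.height_le (hγ p).le (hγΓ p) (hσ' p).2 k)
  refine ⟨F, fun p β => ?_, potentialFlow_isApproximatelyInner φ F g hg⟩
  rw [exists_conformal_iff_summable φ F (x p) (hx p) (s p) (hs p) β,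
    S.summable_iff (hγ p) (hσ p) (hlo p) (hup p) β]
  have hpos : 0 < -β₀ p := neg_pos.2 (hβ₀ p)
  have h1 : 1 < -β * γ p ↔ β < β₀ p := by
    rw [← div_eq_mul_inv, one_lt_div hpos, neg_lt_neg_iff]
  have h2 : -β * γ p = 1 ↔ β = β₀ p := by
    rw [← div_eq_mul_inv, div_eq_one_iff_eq hpos.ne', neg_inj]
  rw [h1, h2]
  rcases hJ p with h | h
  · have : σ p = 1 := by simp [σ, h]
    simp [h, this, le_iff_lt_or_eq]
  · have : σ p = -1 := by simp [σ, h]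
    rw [h, this, Set.mem_Iio]
    norm_num
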